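/- Let $X_1,X_2,X_3,X_4$ be binary variables. The four-cycle model consists of the probability distributions $p$ on $\{0,1\}^4$ of the form $p_{x_1x_2x_3x_4}=\psi_{12}(x_1,x_2)\,\psi_{23}(x_2,x_3)\,\psi_{34}(x_3,x_4)\,\psi_{14}(x_1,x_4)$ with nonnegative potentials; the extended model is its closure. Consider the table of $13$ counts with $m_{1011}=2$, $m_{1100}=m_{1101}=m_{1110}=m_{1111}=0$ and all other $m_{ijkl}=1$. A maximum likelihood estimate (MLE) is a maximizer $\hat p$ of $\prod_x p_x^{m_x}$ over the extended model, and $\hat m=13\,\hat p$ are the estimated counts. Write $a,b,\dots,l$ for the counts in the twelve cells $0000,0001,\dots,1011$ (in this order), and let $I\subset\mathbb{Q}[a,\dots,l]$ be the ideal of the likelihood equations of the simplified four-cycle model, generated by $$ch-dg,\quad bl-dj,\quad ak-ci,\quad af-be,\quad ehjk-fgil,$$ $$a+b+c+d-4,\quad e+f+g+h-4,\quad i+j+k+l-5,\quad a+b+i+j-4,$$ $$c+g+k-3,\quad d+h+l-4,\quad b+f+d+h-4,\quad i+k-2.$$ Let $$\psi(l)=l^5-\tfrac{362}{39}l^4+\tfrac{6713}{351}l^3+\tfrac{110}{9}l^2-\tfrac{2368}{39}l+\tfrac{480}{13}.$$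 (i) The following twelve polynomials form a Gröbner basis of $I$ for the lexicographic order with $a>b>\dots>l$: $\psi(l)$, $k+\tfrac{6539}{22304}l^4-\tfrac{58985}{33456}l^3-\tfrac{513737}{602208}l^2+\tfrac{490447}{100368}l-\tfrac{585}{2788}$, $\;j+l-3$, $\;i+j+k+l-5$, $\;h+\tfrac18k^2-\tfrac1{16}kl+\tfrac14k-\tfrac3{16}l^2+\tfrac1{16}l-\tfrac78$, $\;g+h-2$, $\;f-2h-2k+3l-2$, $\;e+f+g+h-4$, $\;d+h+l-4$, $\;c+g+k-3$, $\;b+f-l$, $\;a-f-g-h-k+3$. The only one of them that lies in $\mathbb{Q}[l]$ is $\psi$, and $I\cap\mathbb{Q}[l]$ is generated by $\psi$. (ii) $\psi$ is irreducible over $\mathbb{Q}$, and its Galois group is isomorphic to the symmetric group $S_5$. (iii) $\psi$ has five real roots, and no complex root of $\psi$ can be expressed by radicals over $\mathbb{Q}$. The MLE exists and is unique; $\hat m_{11kl}=0$ for all $k,l$, and its other twelve coordinates form the unique nonnegative real solution of the equations of $I$. The coordinate $\hat m_{1011}$ is a root of $\psi$; it is irrational and cannot be expressed by radicals over $\mathbb{Q}$.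 In particular the MLE is not rational. -/

import Mathlib

open MvPolynomial

noncomputable section

namespace FourCycle

/-! ## The binary four-cycle model, the data, and maximum likelihood -/

/-- The states `(x₁, x₂, x₃, x₄)` of four binary variables. -/
abbrev Cell : Type := Fin 2 × Fin 2 × Fin 2 × Fin 2

/-- `p` factors according to the four-cycle `X₁ - X₂ - X₃ - X₄ - X₁`: it is a product of nonnegative
potentials, one for each edge (constants of proportionality are absorbed in the potentials). -/
def Factors (p : Cell → ℝ) : Prop :=
  ∃ t₁₂ t₂₃ t₃₄ t₁₄ : Fin 2 → Fin 2 → NNReal, ∀ x₁ x₂ x₃ x₄ : Fin 2,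
    p (x₁, x₂, x₃, x₄) = t₁₂ x₁ x₂ * t₂₃ x₂ x₃ * t₃₄ x₃ x₄ * t₁₄ x₁ x₄

/-- The probability distributions that factor according to the four-cycle. -/
def model : Set (Cell → ℝ) := {p | p ∈ stdSimplex ℝ Cell ∧ Factors p}

/-- The extended model: the distributions that factor, and their limits. -/
def extendedModel : Set (Cell → ℝ) := closure model

/-- The table of counts: 1 in every cell, except that the cell `1011` has count 2 and the four cells
`11kl` have count 0. -/
def counts : Cell → ℕ := fun x =>
  if x = (1, 0, 1, 1) then 2 else if x.1 = 1 ∧ x.2.1 = 1 then 0 else 1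

/-- The likelihood of a distribution for the data `counts`. -/
def likelihood (p : Cell → ℝ) : ℝ := ∏ x, p x ^ counts x

/-- `p` is a maximum likelihood estimate in the extended four-cycle model. -/
def IsMLE (p : Cell → ℝ) : Prop :=
  p ∈ extendedModel ∧ IsMaxOn likelihood extendedModel p

/-- The estimated cell counts belonging to the distribution `p`: `p` times the sample size. -/
def estCount (p : Cell → ℝ) (x : Cell) : ℝ := (∑ y, counts y : ℕ) * p x

/-- The twelve cells `0000, 0001, …, 1011`, in this order; they index the variables `a, b, …, l`. -/
def cell : Fin 12 → Cell :=
  ![(0, 0, 0, 0), (0, 0, 0, 1), (0, 0, 1, 0), (0, 0, 1, 1),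
    (0, 1, 0, 0), (0, 1, 0, 1), (0, 1, 1, 0), (0, 1, 1, 1),
    (1, 0, 0, 0), (1, 0, 0, 1), (1, 0, 1, 0), (1, 0, 1, 1)]

/-! ## The likelihood equations of the simplified four-cycle model -/

/-- The polynomial ring `ℚ[a, b, …, l]`. -/
abbrev R : Type := MvPolynomial (Fin 12) ℚ

/-- The variable for the cell `0000`. -/
def a : R := X 0
/-- The variable for the cell `0001`. -/
def b : R := X 1
/-- The variable for the cell `0010`. -/
def c : R := X 2
/-- The variable for the cell `0011`. -/
def d : R := X 3
/-- The variable for the cell `0100`. -/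
def e : R := X 4
/-- The variable for the cell `0101`. -/
def f : R := X 5
/-- The variable for the cell `0110`. -/
def g : R := X 6
/-- The variable for the cell `0111`. -/
def h : R := X 7
/-- The variable for the cell `1000`. -/
def i : R := X 8
/-- The variable for the cell `1001`. -/
def j : R := X 9
/-- The variable for the cell `1010`. -/
def k : R := X 10
/-- The variable for the cell `1011`. -/
def l : R := X 11

/-- The ideal of the likelihood equations of the simplified four-cycle model: five binomials for the
model, and eight linear equations that equate the clique marginals with those of the data. -/
def mleIdeal : Ideal R :=
  Ideal.span
    {c * h - d * g, b * l - d * j, a * k - c * i, a * f - b * e, e * h * j * k - f * g * i * l,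
      a + b + c + d - 4, e + f + g + h - 4, i + j + k + l - 5, a + b + i + j - 4,
      c + g + k - 3, d + h + l - 4, b + f + d + h - 4, i + k - 2}

/-! ## The Gröbner basis and the quintic -/

/-- `G` is a Gröbner basis of the ideal `I` for the monomial order `m`: a finite ideal basis whose
leading terms generate the ideal of all leading terms of `I`. -/
def IsGroebnerBasis {σ K : Type*} [Field K] (m : MonomialOrder σ)
    (G : Set (MvPolynomial σ K)) (I : Ideal (MvPolynomial σ K)) : Prop :=
  G.Finite ∧ Ideal.span G = I ∧
    Ideal.span (m.leadingTerm '' G) = Ideal.span (m.leadingTerm '' (I : Set (MvPolynomial σ K)))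

/-- The quintic `ψ`. -/
def psi : Polynomial ℚ :=
  Polynomial.X ^ 5 - Polynomial.C (362 / 39) * Polynomial.X ^ 4
    + Polynomial.C (6713 / 351) * Polynomial.X ^ 3 + Polynomial.C (110 / 9) * Polynomial.X ^ 2
    - Polynomial.C (2368 / 39) * Polynomial.X + Polynomial.C (480 / 13)

/-- The inclusion `ℚ[X] → ℚ[a, …, l]` that sends `X` to the last variable `l`. -/
def inclL : Polynomial ℚ →ₐ[ℚ] R := Polynomial.aeval l

/-- The twelve polynomials of the lexicographic Gröbner basis. -/
def lexBasis : Set R :=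
  {inclL psi,
    k + C (6539 / 22304) * l ^ 4 - C (58985 / 33456) * l ^ 3 - C (513737 / 602208) * l ^ 2
      + C (490447 / 100368) * l - C (585 / 2788),
    j + l - 3,
    i + j + k + l - 5,
    h + C (1 / 8) * k ^ 2 - C (1 / 16) * k * l + C (1 / 4) * k - C (3 / 16) * l ^ 2
      + C (1 / 16) * l - C (7 / 8),
    g + h - 2,
    f - 2 * h - 2 * k + 3 * l - 2,
    e + f + g + h - 4,
    d + h + l - 4,
    c + g + k - 3,
    b + f - l,
    a - f - g - h - k + 3}

end FourCycle

end

/-! Algebra. The linear equations leave f, h, k, l free. Combining the four quadrics then expresses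
f and h through k and l, and two curves in the (k, l)-plane remain, from which ψ(l) and a formula
for k follow. This passage to triangular form is reversible in every commutative ℚ-algebra
(`likelihoodEqs_iff_triangularEqs`), so the two ideals coincide. All basis elements but ψ(l) have a
single variable as leading term. The Gröbner property therefore reduces to I ∩ ℚ[l] = (ψ), which
holds because ψ is irreducible and vanishes at the last coordinate of a point of I.

Galois group. Substituting x/117 makes ψ integral and monic up to a constant. That quintic is
irreducible modulo 11. Modulo 31 it splits into three distinct linear factors and an irreducible
quadratic, so Frobenius at 31 acts on the roots as a transposition. A group of permutations of five
points whose order is divisible by 5 and which contains a transposition is S₅, hence ψ is not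
solvable by radicals.

Statistics. Of the five real roots only the one near 1.758 gives nonnegative coordinates, and there
all twelve are positive. On the extended model the quadratic binomials hold, and the linear
equations make the data minus the solution v orthogonal to log q. So the log-likelihood of a
positive q equals ∑ v log q, and Gibbs' inequality makes v/13 the strict maximizer
(`likelihood_lt`). -/

open scoped MonomialOrder


/-! ### Elimination: the triangular form of the likelihood equations -/

namespace FourCycle

/-- The likelihood equations of the simplified four-cycle model, in a commutative ring. -/
def LikelihoodEqs {A : Type*} [CommRing A] (a b c d e f g h i j k l : A) : Prop :=
  c * h - d * g = 0 ∧ b * l - d * j = 0 ∧ a * k - c * i = 0 ∧ a * f - b * e = 0 ∧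
    e * h * j * k - f * g * i * l = 0 ∧ a + b + c + d - 4 = 0 ∧ e + f + g + h - 4 = 0 ∧
    i + j + k + l - 5 = 0 ∧ a + b + i + j - 4 = 0 ∧ c + g + k - 3 = 0 ∧ d + h + l - 4 = 0 ∧
    b + f + d + h - 4 = 0 ∧ i + k - 2 = 0

/-- The triangular system of the lexicographic Gröbner basis, with denominators cleared. -/
def TriangularEqs {A : Type*} [CommRing A] (a b c d e f g h i j k l : A) : Prop :=
  351*l^5 - 3258*l^4 + 6713*l^3 + 4290*l^2 - 21312*l + 12960 = 0 ∧
    602208*k + 176553*l^4 - 1061730*l^3 - 513737*l^2 + 2942682*l - 126360 = 0 ∧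
    j + l - 3 = 0 ∧ i + j + k + l - 5 = 0 ∧
    16 * h + 2 * k ^ 2 - k * l + 4 * k - 3 * l ^ 2 + l - 14 = 0 ∧
    g + h - 2 = 0 ∧ f - 2 * h - 2 * k + 3 * l - 2 = 0 ∧ e + f + g + h - 4 = 0 ∧
    d + h + l - 4 = 0 ∧ c + g + k - 3 = 0 ∧ b + f - l = 0 ∧ a - f - g - h - k + 3 = 0

/-- Positive integers are units in a ℚ-algebra; this allows elimination certificates with integer
coefficients. -/
theorem eq_zero_of_natCast_mul_eq_zero {A : Type*} [CommRing A] [Algebra ℚ A] (n : ℕ) [NeZero n]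
    {x : A} (hx : (n : A) * x = 0) : x = 0 := by
  have hn : algebraMap ℚ A (1 / n) * (n : A) = 1 := by
    rw [← map_natCast (algebraMap ℚ A), ← map_mul,
      one_div_mul_cancel (Nat.cast_ne_zero.mpr (NeZero.ne n)), map_one]
  rw [← one_mul x, ← hn, mul_assoc, hx, mul_zero]

/-- The generality in `A` serves two purposes: quotients of the polynomial ring give the equality of
ideals, and ℝ gives the description of the real solutions. -/
theorem likelihoodEqs_iff_triangularEqs {A : Type*} [CommRing A] [Algebra ℚ A]
    (a b c d e f g h i j k l : A) :
    LikelihoodEqs a b c d e f g h i j k l ↔ TriangularEqs a b c d e f g h i j k l := by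
  constructor
  · rintro ⟨h₁, h₂, h₃, h₄, -, s₁, s₂, s₃, s₄, s₅, s₆, s₇, s₈⟩
    obtain rfl : j = 3 - l := by linear_combination s₃ - s₈
    obtain rfl : i = 2 - k := by linear_combination s₈
    obtain rfl : d = 4 - h - l := by linear_combination s₆
    obtain rfl : b = l - f := by linear_combination s₇ - s₆ 
    obtain rfl : a = f + k - 1 := by linear_combination s₄ - s₇ + s₆
    obtain rfl : c = 1 + h - k := by linear_combination s₁ - s₄
    obtain rfl : g = 2 - h := by linear_combination s₅ 
    obtain rfl : e = 2 - f := by linear_combination s₂ 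
    -- In this alternating sum of the quadrics all terms of degree two cancel.
    obtain rfl : f = 2 * h + 2 * k - 3 * l + 2 := by linear_combination h₄ + h₂ - h₃ - h₁
    -- The weights are such that the coefficient of h, a polynomial in k and l, collapses to the
    -- constant 16.
    have hh : 16 * h + 2 * k ^ 2 - k * l + 4 * k - 3 * l ^ 2 + l - 14 = 0 := by
      linear_combination h₃ - h₂ + 3 * h₁
    -- h₁ and h₂ are linear in h, so `hh` eliminates h from them. The quintic and the formula for k
    -- are explicit combinations of the resulting q₁ and q₂.
    have q₁ : 2*k^3 + k^2*l - 10*k^2 - 4*k*l^2 + 12*k*l - 42*k - 3*l^3 + 22*l^2 + 11*l - 30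
        = 0 := by
      linear_combination 16 * h₁ - (7 - k - l) * hh
    have q₂ : 6*k^2*l - 6*k^2 - 3*k*l^2 - 17*k*l - 12*k - 9*l^3 + 60*l^2 + 35*l - 150 = 0 := by
      linear_combination 16 * h₂ - (3 - 3 * l) * hh
    refine ⟨eq_zero_of_natCast_mul_eq_zero 64 ?_, eq_zero_of_natCast_mul_eq_zero 64 ?_,
      by ring, by ring, hh, by ring, by ring, by ring, by ring, by ring, by ring, by ring⟩
    · push_cast
      linear_combination (- 222*k*l^3 + 852*k*l^2 - 846*k*l + 216*k + 21*l^4 + 704*l^3 - 1047*l^2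
          - 2214*l + 1512) * q₁ + (74*k^2*l^2 - 210*k^2*l + 72*k^2 + 67*k*l^3 - 575*k*l^2 + 924*k*l
          - 7*l^4 - 230*l^3 - 1961*l^2 + 8286*l - 5832) * q₂
    · push_cast
      linear_combination (- 111666*k*l^2 + 63588*k*l + 48078*k + 10563*l^3 + 388636*l^2 + 718431*l
          - 265662) * q₁ + (37222*k^2*l + 16026*k^2 + 33701*k*l^2 - 179077*k*l - 200736*k - 3521*l^3
          - 127198*l^2 - 1393735*l + 107046) * q₂
  · rintro ⟨p, K, s₁, s₂, hh, s₃, s₄, s₅, s₆, s₇, s₈, s₉⟩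
    obtain rfl : j = 3 - l := by linear_combination s₁
    obtain rfl : i = 2 - k := by linear_combination s₂
    obtain rfl : d = 4 - h - l := by linear_combination s₆
    obtain rfl : g = 2 - h := by linear_combination s₃
    obtain rfl : c = 1 + h - k := by linear_combination s₇
    obtain rfl : b = l - f := by linear_combination s₈
    obtain rfl : a = f + k - 1 := by linear_combination s₉
    obtain rfl : e = 2 - f := by linear_combination s₅
    obtain rfl : f = 2 * h + 2 * k - 3 * l + 2 := by linear_combination s₄
    have q₁ : 2*k^3 + k^2*l - 10*k^2 - 4*k*l^2 + 12*k*l - 42*k - 3*l^3 + 22*l^2 + 11*l - 30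
        = 0 := by
      -- This is 602208 · 100368², and the multiplier for q₂ is 602208 · 100368, where 100368 =
      -- 602208 / 6. They absorb the denominators that arise when k is replaced by its quartic in l.
      refine eq_zero_of_natCast_mul_eq_zero 6066484062216192 ?_
      push_cast
      linear_combination (20147470848*k^2 - 5906757168*k*l^4 + 35521238880*k*l^3 + 17187585072*k*l^2
          - 88376633568*k*l - 96509854080*k - 44120080485*l^5 + 347956007022*l^4 - 372800684227*l^3
          - 1011299250246*l^2 + 1485893287008*l - 443347341408) * K + (2971098855504*k*l^3
          - 8156474372448*k*l^2 - 42375654076368*k*l + 22192400483955*l^4 - 102488459214726*l^3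
          - 200275475272627*l^2 + 90101476124334*l - 18365423759784) * p
    have q₂ : 6*k^2*l - 6*k^2 - 3*k*l^2 - 17*k*l - 12*k - 9*l^3 + 60*l^2 + 35*l - 150 = 0 := by
      refine eq_zero_of_natCast_mul_eq_zero 60442412544 ?_
      push_cast
      linear_combination (602208*k*l - 602208*k - 400491*l^4 + 2828646*l^3 - 1599653*l^2 - 9357150*l
          + 5188104) * K + (- 302910624*k + 201446973*l^3 - 764401734*l^2 - 2173218149*l
          - 648980946) * p
    have h₁ : (1 + h - k) * h - (4 - h - l) * (2 - h) = 0 := by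
      refine eq_zero_of_natCast_mul_eq_zero 16 ?_
      push_cast
      linear_combination q₁ + (7 - k - l) * hh
    have h₂ : (l - (2 * h + 2 * k - 3 * l + 2)) * l - (4 - h - l) * (3 - l) = 0 := by
      refine eq_zero_of_natCast_mul_eq_zero 16 ?_
      push_cast
      linear_combination q₂ + (3 - 3 * l) * hh
    have h₃ : (2 * h + 2 * k - 3 * l + 2 + k - 1) * k - (1 + h - k) * (2 - k) = 0 := by
      linear_combination hh + h₂ - 3 * h₁
    refine ⟨h₁, h₂, h₃, ?_, ?_, by ring, by ring, by ring, by ring, by ring, by ring, by ring,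
      by ring⟩
    · linear_combination h₁ - h₂ + h₃
    · refine eq_zero_of_natCast_mul_eq_zero 256 ?_
      push_cast
      linear_combination (- 12*k^2 + 14*k*l + 6*l^2 - 50*l + 60) * q₁ + (4*k^2 - 2*k*l - 8*k - 6*l^2
          + 26*l - 12) * q₂ + ((3 - l) * k * (32 - (- 4*k^2 + 2*k*l + 24*k + 6*l^2 - 50*l + 60) - 32
          * h) + (2 - k) * l * ((- 4*k^2 + 2*k*l + 24*k + 6*l^2 - 50*l + 60) - 64 + 32 * h)) * hh

theorem psi_inclL : inclL psi = l ^ 5 - (C (362 / 39) : R) * l ^ 4 + (C (6713 / 351) : R) * l ^ 3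
    + (C (110 / 9) : R) * l ^ 2 - (C (2368 / 39) : R) * l + (C (480 / 13) : R) := by
  simp [inclL, psi, MvPolynomial.algebraMap_eq]

theorem C_div_eq (q : ℚ) (m n : ℕ) (hq : q = m * (1 / n)) :
    (C q : R) = (m : R) * (C (1 / (n : ℚ)) : R) := by
  rw [hq, C_mul, map_natCast]

theorem natCast_mul_C_one_div (n : ℕ) (hn : n ≠ 0) : (n : R) * (C (1 / (n : ℚ)) : R) = 1 := by
  rw [← map_natCast (C : ℚ →+* R), ← C_mul, mul_one_div_cancel (Nat.cast_ne_zero.mpr hn), C_1]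

theorem clear_psi : ((351 : ℕ) : R) * inclL psi =
    351 * l ^ 5 - 3258 * l ^ 4 + 6713 * l ^ 3 + 4290 * l ^ 2 - 21312 * l + 12960 := by
  have t := natCast_mul_C_one_div 351 (by norm_num)
  rw [psi_inclL, C_div_eq (362 / 39) 3258 351 (by norm_num),
    C_div_eq (6713 / 351) 6713 351 (by norm_num), C_div_eq (110 / 9) 4290 351 (by norm_num),
    C_div_eq (2368 / 39) 21312 351 (by norm_num), C_div_eq (480 / 13) 12960 351 (by norm_num)]
  push_cast at t ⊢
  linear_combination (- 3258 * l ^ 4 + 6713 * l ^ 3 + 4290 * l ^ 2 - 21312 * l + 12960) * t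

theorem clear_k : ((602208 : ℕ) : R) * (k + C (6539 / 22304) * l ^ 4 - C (58985 / 33456) * l ^ 3
      - C (513737 / 602208) * l ^ 2 + C (490447 / 100368) * l - C (585 / 2788)) =
    602208 * k + 176553 * l ^ 4 - 1061730 * l ^ 3 - 513737 * l ^ 2 + 2942682 * l - 126360 := by
  have t := natCast_mul_C_one_div 602208 (by norm_num)
  rw [C_div_eq (6539 / 22304) 176553 602208 (by norm_num),
    C_div_eq (58985 / 33456) 1061730 602208 (by norm_num),
    C_div_eq (513737 / 602208) 513737 602208 (by norm_num),
    C_div_eq (490447 / 100368) 2942682 602208 (by norm_num),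
    C_div_eq (585 / 2788) 126360 602208 (by norm_num)]
  push_cast at t ⊢
  linear_combination
    (176553 * l ^ 4 - 1061730 * l ^ 3 - 513737 * l ^ 2 + 2942682 * l - 126360) * t

theorem clear_h : ((16 : ℕ) : R) * (h + C (1 / 8) * k ^ 2 - C (1 / 16) * k * l + C (1 / 4) * k
      - C (3 / 16) * l ^ 2 + C (1 / 16) * l - C (7 / 8)) =
    16 * h + 2 * k ^ 2 - k * l + 4 * k - 3 * l ^ 2 + l - 14 := by
  have t := natCast_mul_C_one_div 16 (by norm_num)
  rw [C_div_eq (1 / 8) 2 16 (by norm_num), C_div_eq (1 / 16) 1 16 (by norm_num),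
    C_div_eq (1 / 4) 4 16 (by norm_num), C_div_eq (3 / 16) 3 16 (by norm_num),
    C_div_eq (7 / 8) 14 16 (by norm_num)]
  push_cast at t ⊢
  linear_combination (2 * k ^ 2 - k * l + 4 * k - 3 * l ^ 2 + l - 14) * t

/-! ### Equality of the two ideals -/

section Points

variable {A : Type*} [CommRing A] [Algebra ℚ A] (φ : R →ₐ[ℚ] A)

theorem forall_mem_mleIdeal_iff : (∀ F ∈ mleIdeal, φ F = 0) ↔
    LikelihoodEqs (φ a) (φ b) (φ c) (φ d) (φ e) (φ f) (φ g) (φ h) (φ i) (φ j) (φ k) (φ l) := by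
  have : (∀ F ∈ mleIdeal, φ F = 0) ↔ mleIdeal ≤ RingHom.ker φ := Iff.rfl
  rw [this, mleIdeal, Ideal.span_le]
  simp only [LikelihoodEqs, Set.insert_subset_iff, Set.singleton_subset_iff, SetLike.mem_coe,
    RingHom.mem_ker, map_add, map_sub, map_mul]
  repeat rw [map_ofNat]

theorem eq_zero_iff_of_natCast_mul_eq (n : ℕ) [NeZero n] {F G : R} (hFG : n * F = G) :
    φ F = 0 ↔ φ G = 0 := by
  rw [← hFG, map_mul, map_natCast]
  exact ⟨fun hF ↦ by rw [hF, mul_zero], eq_zero_of_natCast_mul_eq_zero n⟩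

theorem forall_mem_lexBasis_iff : (∀ F ∈ lexBasis, φ F = 0) ↔
    TriangularEqs (φ a) (φ b) (φ c) (φ d) (φ e) (φ f) (φ g) (φ h) (φ i) (φ j) (φ k) (φ l) := by
  simp only [lexBasis, Set.forall_mem_insert, Set.mem_singleton_iff, forall_eq]
  rw [eq_zero_iff_of_natCast_mul_eq φ 351 clear_psi, eq_zero_iff_of_natCast_mul_eq φ 602208 clear_k,
    eq_zero_iff_of_natCast_mul_eq φ 16 clear_h]
  simp only [TriangularEqs, map_add, map_sub, map_mul, map_pow]
  repeat rw [map_ofNat]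

end Points

/-- The quotient map modulo an ideal is a zero of that ideal with values in a ℚ-algebra; each
inclusion applies the equivalence of the two systems to this generic point. -/
theorem span_lexBasis : Ideal.span lexBasis = mleIdeal := by
  apply le_antisymm
  · rw [Ideal.span_le]
    intro F hF
    rw [SetLike.mem_coe, ← Ideal.Quotient.eq_zero_iff_mem]
    refine (forall_mem_lexBasis_iff (Ideal.Quotient.mkₐ ℚ mleIdeal)).mpr ?_ F hF
    rw [← likelihoodEqs_iff_triangularEqs, ← forall_mem_mleIdeal_iff]
    exact fun F hF ↦ Ideal.Quotient.eq_zero_iff_mem.mpr hF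
  · intro F hF
    rw [← Ideal.Quotient.eq_zero_iff_mem]
    refine (forall_mem_mleIdeal_iff (Ideal.Quotient.mkₐ ℚ (Ideal.span lexBasis))).mpr ?_ F hF
    rw [likelihoodEqs_iff_triangularEqs, ← forall_mem_lexBasis_iff]
    exact fun F hF ↦ Ideal.Quotient.eq_zero_iff_mem.mpr (Ideal.subset_span hF)

/-! ### Leading terms and the Gröbner property -/

/-- The elements of the lexicographic basis other than `ψ(l)`, without their leading terms. -/
noncomputable def tail : Fin 11 → R :=
  ![-f - g - h - k + 3, f - l, g + k - 3, h + l - 4, f + g + h - 4, -2 * h - 2 * k + 3 * l - 2,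
    h - 2,
    C (1 / 8) * k ^ 2 - C (1 / 16) * k * l + C (1 / 4) * k - C (3 / 16) * l ^ 2
      + C (1 / 16) * l - C (7 / 8),
    j + k + l - 5, l - 3,
    C (6539 / 22304) * l ^ 4 - C (58985 / 33456) * l ^ 3 - C (513737 / 602208) * l ^ 2
      + C (490447 / 100368) * l - C (585 / 2788)]

theorem lexBasis_eq :
    lexBasis = insert (inclL psi) (Set.range fun n : Fin 11 ↦ X n.castSucc + tail n) := by
  have hr : (fun n : Fin 11 ↦ X n.castSucc + tail n) = ![a - f - g - h - k + 3, b + f - l,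
      c + g + k - 3, d + h + l - 4, e + f + g + h - 4, f - 2 * h - 2 * k + 3 * l - 2, g + h - 2,
      h + C (1 / 8) * k ^ 2 - C (1 / 16) * k * l + C (1 / 4) * k - C (3 / 16) * l ^ 2
        + C (1 / 16) * l - C (7 / 8),
      i + j + k + l - 5, j + l - 3,
      k + C (6539 / 22304) * l ^ 4 - C (58985 / 33456) * l ^ 3 - C (513737 / 602208) * l ^ 2
        + C (490447 / 100368) * l - C (585 / 2788)] := by
    funext n
    fin_cases n
    · change a + (-f - g - h - k + 3) =
        a - f - g - h - k + 3
      ring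
    · change b + (f - l) =
        b + f - l
      ring
    · change c + (g + k - 3) =
        c + g + k - 3
      ring
    · change d + (h + l - 4) =
        d + h + l - 4
      ring
    · change e + (f + g + h - 4) =
        e + f + g + h - 4
      ring
    · change f + (-2 * h - 2 * k + 3 * l - 2) =
        f - 2 * h - 2 * k + 3 * l - 2
      ring
    · change g + (h - 2) =
        g + h - 2
      ring
    · change h + (C (1 / 8) * k ^ 2 - C (1 / 16) * k * l + C (1 / 4) * k - C (3 / 16) * l ^ 2
        + C (1 / 16) * l - C (7 / 8)) =
        h + C (1 / 8) * k ^ 2 - C (1 / 16) * k * l + C (1 / 4) * k - C (3 / 16) * l ^ 2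
        + C (1 / 16) * l - C (7 / 8)
      ring
    · change i + (j + k + l - 5) =
        i + j + k + l - 5
      ring
    · change j + (l - 3) =
        j + l - 3
      ring
    · change k + (C (6539 / 22304) * l ^ 4 - C (58985 / 33456) * l ^ 3 - C (513737 / 602208) * l ^ 2
        + C (490447 / 100368) * l - C (585 / 2788)) =
        k + C (6539 / 22304) * l ^ 4 - C (58985 / 33456) * l ^ 3 - C (513737 / 602208) * l ^ 2
        + C (490447 / 100368) * l - C (585 / 2788)
      ring
  rw [hr, lexBasis]
  simp only [Matrix.range_cons, Matrix.range_empty, Set.union_empty, Set.singleton_union]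
  ext F
  simp only [Set.mem_insert_iff, Set.mem_singleton_iff]
  tauto

theorem X_mem_supported_Ioi {m n : Fin 12} (hmn : m < n) :
    (X n : R) ∈ supported ℚ (Set.Ioi m) := X_mem_supported.mpr hmn

theorem C_mem_supported (s : Set (Fin 12)) (q : ℚ) : (C q : R) ∈ supported ℚ s :=
  (supported ℚ s).algebraMap_mem q

theorem ofNat_mem_supported (s : Set (Fin 12)) (n : ℕ) [n.AtLeastTwo] :
    (OfNat.ofNat n : R) ∈ supported ℚ s := ofNat_mem _ n

theorem tail_mem_supported (n : Fin 11) : tail n ∈ supported ℚ (Set.Ioi n.castSucc) := by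
  fin_cases n <;>
  · repeat' first
      | apply sub_mem | apply add_mem | apply mul_mem | apply neg_mem | apply pow_mem
      | apply C_mem_supported | apply ofNat_mem_supported
      | exact X_mem_supported_Ioi (by decide)

theorem range_inclL : inclL.range = supported ℚ {11} := by
  rw [inclL, ← Algebra.adjoin_singleton_eq_range_aeval, supported_eq_adjoin_X, Set.image_singleton,
    l]

theorem inclL_injective : Function.Injective inclL := by
  refine Function.LeftInverse.injective (g := aeval fun _ ↦ Polynomial.X) fun q ↦ ?_
  rw [inclL, ← Polynomial.aeval_algHom_apply, l, aeval_X, Polynomial.aeval_X_left_apply]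

theorem setOf_inclL_mem_lexBasis : {q : Polynomial ℚ | inclL q ∈ lexBasis} = {psi} := by
  ext q
  rw [Set.mem_ofPred_eq, lexBasis_eq, Set.mem_insert_iff, inclL_injective.eq_iff,
    Set.mem_singleton_iff, or_iff_left]
  rintro ⟨n, hn⟩
  have hq : inclL q ∈ supported ℚ (Set.Ioi n.castSucc) := by
    refine supported_mono ?_ (range_inclL.le ⟨q, rfl⟩)
    rw [Set.singleton_subset_iff]
    exact n.castSucc_lt_last
  have := sub_mem hq (tail_mem_supported n)
  rw [← hn, add_sub_cancel_right, X_mem_supported] at this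
  exact lt_irrefl _ (Set.mem_Ioi.mp this)

section Lex

variable {σ : Type*} [LinearOrder σ] [WellFoundedGT σ] {K : Type*} [Field K]

theorem degree_lex_lt_single {n : σ} {r : MvPolynomial σ K} (hr : r ∈ supported K (Set.Ioi n)) :
    MonomialOrder.lex.degree r ≺[MonomialOrder.lex] Finsupp.single n 1 := by
  have hlt {m : σ →₀ ℕ} (hm : ∀ i ≤ n, m i = 0) : m ≺[MonomialOrder.lex] Finsupp.single n 1 := by
    rw [MonomialOrder.lex_lt_iff, Finsupp.Lex.lt_iff]
    refine ⟨n, fun i hi ↦ ?_, ?_⟩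
    · simp [hm i hi.le, hi.ne]
    · simp [hm n le_rfl]
  rw [MonomialOrder.degree_lt_iff (by simpa using hlt (m := 0) (by simp))]
  refine fun m hm ↦ hlt fun i hi ↦ ?_
  by_contra hmi
  exact (mem_supported.mp hr (mem_vars_iff_mem_support i |>.mpr ⟨m, hm,
      Finsupp.mem_support_iff.mpr hmi⟩)).not_ge hi

theorem leadingTerm_X_add {n : σ} {r : MvPolynomial σ K} (hr : r ∈ supported K (Set.Ioi n)) :
    MonomialOrder.lex.leadingTerm (X n + r) = X n := by
  have hlt : MonomialOrder.lex.degree r ≺[MonomialOrder.lex]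
      MonomialOrder.lex.degree (X n : MvPolynomial σ K) := by
    rw [MonomialOrder.degree_X]
    exact degree_lex_lt_single hr
  rw [MonomialOrder.leadingTerm, MonomialOrder.degree_add_of_lt hlt,
    MonomialOrder.leadingCoeff_add_of_lt hlt, MonomialOrder.degree_X, MonomialOrder.leadingCoeff_X,
    X]

/-- A monomial containing any variable before the last one is lexicographically larger than every
power of the last one, so the leading monomial controls all the others. -/
theorem mem_supported_of_degree_lex {n : σ} (hn : ∀ i, i ≤ n) {F : MvPolynomial σ K}
    (hF : ∀ i ≠ n, MonomialOrder.lex.degree F i = 0) : F ∈ supported K {n} := by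
  rw [mem_supported]
  intro i hi
  obtain ⟨m, hm, him⟩ := (mem_vars_iff_mem_support i).mp hi
  by_contra hin
  have hle := MonomialOrder.lex.le_degree hm
  refine hle.not_gt ?_
  rw [MonomialOrder.lex_lt_iff, Finsupp.Lex.lt_iff]
  obtain ⟨i₀, hi₀, hmin⟩ : ∃ i₀, m i₀ ≠ 0 ∧ ∀ i' < i₀, m i' = 0 := by
    have hs : m.support.Nonempty := ⟨i, him⟩
    refine ⟨m.support.min' hs, Finsupp.mem_support_iff.mp (m.support.min'_mem hs), fun i' hi' ↦ ?_⟩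
    by_contra h
    exact (m.support.min'_le i' (Finsupp.mem_support_iff.mpr h)).not_gt hi'
  have hlt : i₀ < n := lt_of_le_of_ne (hn i₀) fun h ↦
    (Finsupp.mem_support_iff.mp him) (hmin i (h ▸ lt_of_le_of_ne (hn i) hin))
  refine ⟨i₀, fun i' hi' ↦ ?_, ?_⟩
  · simp [hmin i' hi', hF i' (hi'.trans hlt).ne]
  · simpa [hF i₀ hlt.ne] using Nat.pos_of_ne_zero hi₀

end Lex

/-- The leading term of a member of I either is divisible by one of the first eleven variables,
which are themselves leading terms of the basis, or is a term in l alone. In the latter case the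
member lies in I ∩ ℚ[l] and is a multiple of ψ(l). -/
theorem isGroebnerBasis_lexBasis (helim : mleIdeal.comap inclL = Ideal.span {psi}) :
    IsGroebnerBasis MonomialOrder.lex lexBasis mleIdeal := by
  refine ⟨?_, span_lexBasis, le_antisymm (Ideal.span_mono (Set.image_mono ?_)) ?_⟩
  · rw [lexBasis_eq]
    exact (Set.finite_range _).insert _
  · rw [← span_lexBasis]
    exact Ideal.subset_span
  rw [Ideal.span_le]
  rintro _ ⟨F, hF, rfl⟩
  by_cases hdeg : ∃ n : Fin 11, MonomialOrder.lex.degree F n.castSucc ≠ 0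
  · obtain ⟨n, hn⟩ := hdeg
    have hX : (X n.castSucc : R) ∈ Ideal.span (MonomialOrder.lex.leadingTerm '' lexBasis) := by
      rw [← leadingTerm_X_add (tail_mem_supported n), lexBasis_eq]
      exact Ideal.subset_span ⟨_, Or.inr ⟨n, rfl⟩, rfl⟩
    refine Ideal.mem_of_dvd _ ?_ hX
    rw [X, MonomialOrder.leadingTerm, monomial_dvd_monomial]
    refine ⟨Or.inr ?_, one_dvd _⟩
    rw [Finsupp.single_le_iff]
    exact Nat.one_le_iff_ne_zero.mpr hn
  · push Not at hdeg
    have hFl : F ∈ supported ℚ {Fin.last 11} := by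
      refine mem_supported_of_degree_lex Fin.le_last fun i hi ↦ ?_
      obtain ⟨n, rfl⟩ := Fin.exists_castSucc_eq.mpr hi
      exact hdeg n
    obtain ⟨q, rfl⟩ := range_inclL.ge hFl
    have hq : q ∈ mleIdeal.comap inclL := hF
    rw [helim, Ideal.mem_span_singleton] at hq
    obtain ⟨w, rfl⟩ := hq
    have : MonomialOrder.lex.leadingTerm (inclL (psi * w)) =
        MonomialOrder.lex.leadingTerm (inclL psi) * MonomialOrder.lex.leadingTerm (inclL w) := by
      rw [map_mul, MonomialOrder.leadingTerm_mul]
    refine Ideal.mem_of_dvd _ ⟨_, this⟩ (Ideal.subset_span ⟨_, ?_, rfl⟩)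
    rw [lexBasis_eq]
    exact Or.inl rfl

end FourCycle

/-! ### Frobenius elements and rescaling -/

section Frobenius

open NumberField Polynomial

theorem exists_frobenius (L : Type*) [Field L] [NumberField L] [IsGalois ℚ L] (p : ℕ)
    [Fact p.Prime] : ∃ (Q : Ideal (𝓞 L)) (σ : L ≃ₐ[ℚ] L), Q.IsPrime ∧ (p : 𝓞 L) ∈ Q ∧
      ∀ x y : 𝓞 L, (y : L) = σ x → Ideal.Quotient.mk Q y = Ideal.Quotient.mk Q x ^ p := by
  have hp : Ideal.span {(p : 𝓞 L)} ≠ ⊤ := by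
    rw [Ne, Ideal.span_singleton_eq_top]
    intro h
    -- The norm of p is a positive power of p, so p is not a unit.
    have h₁ := h.map (Algebra.norm ℤ)
    rw [← map_natCast (algebraMap ℤ (𝓞 L)), Algebra.norm_algebraMap, isUnit_pow_iff
      (Module.finrank_pos).ne', Int.isUnit_iff_natAbs_eq, Int.natAbs_natCast] at h₁
    exact (Fact.out : p.Prime).one_lt.ne' h₁
  obtain ⟨Q, hQ, hpQ⟩ := Ideal.exists_le_maximal _ hp
  rw [Ideal.span_singleton_le_iff_mem] at hpQ
  have hfin : Finite (𝓞 L ⧸ Q) := Q.finiteQuotientOfFreeOfNeBot fun h ↦ by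
    rw [h, Ideal.mem_bot] at hpQ
    exact (Fact.out : p.Prime).ne_zero (by exact_mod_cast hpQ)
  have hfinG : Finite (𝓞 L ≃ₐ[ℤ] 𝓞 L) := Finite.of_equiv _ (galRestrict ℤ ℚ L (𝓞 L)).toEquiv
  have hinv := Algebra.isInvariant_of_isGalois' ℤ ℚ L (𝓞 L)
  obtain ⟨τ, hτ⟩ := IsArithFrobAt.exists_of_isInvariant ℤ (𝓞 L ≃ₐ[ℤ] 𝓞 L) Q
  have hunder : Q.under ℤ = Ideal.span {(p : ℤ)} := by
    have hmax : (Ideal.span {(p : ℤ)}).IsMaximal :=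
      PrincipalIdealRing.isMaximal_of_irreducible
        (Nat.prime_iff_prime_int.mp (Fact.out : p.Prime)).irreducible
    refine (hmax.eq_of_le (Ideal.IsPrime.under ℤ Q).ne_top ?_).symm
    rw [Ideal.span_singleton_le_iff_mem, Ideal.mem_comap]
    simpa using hpQ
  have hcard : Nat.card (ℤ ⧸ Q.under ℤ) = p := by
    rw [hunder, Nat.card_congr (Int.quotientSpanNatEquivZMod p).toEquiv, Nat.card_zmod]
  refine ⟨Q, (galRestrict ℤ ℚ L (𝓞 L)).symm τ, hQ.isPrime, hpQ, fun x y hxy ↦ ?_⟩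
  have hy : y = τ x := by
    refine RingOfIntegers.ext ?_
    rw [hxy]
    exact (algebraMap_galRestrict_apply ℤ ((galRestrict ℤ ℚ L (𝓞 L)).symm τ) x).symm.trans
      (by rw [MulEquiv.apply_symm_apply])
  have := hτ.mk_apply x
  rw [hcard] at this
  rw [hy]
  exact this

end Frobenius

section Scale

open Polynomial

/-- Substituting a nonzero multiple of the variable, and multiplying by a nonzero constant, do not
change the Galois group. -/
theorem Polynomial.Gal.nonempty_mulEquiv_C_mul_comp_C_mul_X {K : Type*} [Field K] (p : K[X])
    {u c : K} (hu : u ≠ 0) (hc : c ≠ 0) : Nonempty ((C u * p.comp (C c * X)).Gal ≃* p.Gal) := by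
  have hsplit : IsSplittingField K p.SplittingField (C u * p.comp (C c * X)) := by
    refine ⟨?_, ?_⟩
    · rw [Polynomial.map_mul, Polynomial.map_C, Polynomial.map_comp]
      exact (Splits.C _).mul <| (SplittingField.splits p).comp_of_natDegree_le_one
        (natDegree_map_le.trans (natDegree_C_mul_le _ _ |>.trans natDegree_X_le))
    · rw [eq_top_iff, ← SplittingField.adjoin_rootSet, Algebra.adjoin_le_iff]
      intro x hx
      have hp : p.comp (C c * X) ≠ 0 := by
        intro h
        apply ne_zero_of_mem_rootSet hx
        have := congrArg (fun r ↦ r.comp (C c⁻¹ * X)) h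
        simpa [comp_assoc, ← mul_assoc, ← C_mul, hc] using this
      have hy : algebraMap K p.SplittingField c⁻¹ * x ∈
          (C u * p.comp (C c * X)).rootSet p.SplittingField := by
        rw [mem_rootSet]
        refine ⟨mul_ne_zero (C_ne_zero.mpr hu) hp, ?_⟩
        rw [map_mul, aeval_comp, map_mul, aeval_C, aeval_C, aeval_X, ← mul_assoc, ← map_mul,
          mul_inv_cancel₀ hc, map_one, one_mul, aeval_eq_zero_of_mem_rootSet hx, mul_zero]
      have : x = algebraMap K p.SplittingField c * (algebraMap K p.SplittingField c⁻¹ * x) := by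
        rw [← mul_assoc, ← map_mul, mul_inv_cancel₀ hc, map_one, one_mul]
      rw [this]
      exact mul_mem (Subalgebra.algebraMap_mem _ _) (Algebra.subset_adjoin hy)
  exact ⟨AlgEquiv.autCongr
    (IsSplittingField.algEquiv p.SplittingField (C u * p.comp (C c * X))).symm⟩

end Scale

/-! ### Irreducibility of the quintic, by reduction modulo 11 -/

namespace FourCycle

open Polynomial

/-- The monic integral polynomial whose roots are `117` times those of `ψ`. -/
noncomputable def integralQuintic : ℤ[X] :=
  Polynomial.X ^ 5 - 1086 * Polynomial.X ^ 4 + 261807 * Polynomial.X ^ 3 + 19575270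
      * Polynomial.X ^ 2 - 11377858752 * Polynomial.X + 809519274720

theorem monic_integralQuintic : integralQuintic.Monic := by
  unfold integralQuintic; monicity!

theorem natDegree_integralQuintic : integralQuintic.natDegree = 5 := by
  unfold integralQuintic; compute_degree!

/-- The denominators of ψ divide 351 = 3³ · 13, and scaling the roots by 117 = 3² · 13 suffices to
clear them all. -/
theorem psi_eq_C_mul_comp : psi = Polynomial.C (1 / 117 ^ 5) *
    (integralQuintic.map (algebraMap ℤ ℚ)).comp (Polynomial.C 117 * Polynomial.X) := by
  refine Polynomial.funext fun t ↦ ?_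
  simp [psi, integralQuintic]
  ring

theorem irreducible_integralQuintic_map :
    Irreducible (integralQuintic.map (Int.castRingHom (ZMod 11))) := by
  have h11 : (11 : ZMod 11) = 0 := by decide
  have hlin : ∀ a : ZMod 11,
      (-a) ^ 5 + 3 * (-a) ^ 4 + 7 * (-a) ^ 3 + 4 * (-a) + 2 ≠ 0 := by decide
  -- The two expressions are the coefficients of the remainder on division by X² + uX + v; they
  -- never vanish together. The quotient is `s` below.
  have hquad : ∀ u v : ZMod 11,
      4 - u * (-u * (7 - u * (3 - u) - v) - v * (3 - u)) - v * (7 - u * (3 - u) - v) = 0 →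
      2 - v * (-u * (7 - u * (3 - u) - v) - v * (3 - u)) ≠ 0 := by decide
  have : Fact (Nat.Prime 11) := ⟨by norm_num⟩
  have hmap : integralQuintic.map (Int.castRingHom (ZMod 11)) =
      Polynomial.X ^ 5 + 3 * Polynomial.X ^ 4 + 7 * Polynomial.X ^ 3 + 4 * Polynomial.X + 2 := by
    have h : (11 : (ZMod 11)[X]) = 0 := by
      rw [← map_ofNat Polynomial.C]
      exact (congrArg Polynomial.C h11).trans Polynomial.C_0
    simp only [integralQuintic, Polynomial.map_add, Polynomial.map_sub, Polynomial.map_mul,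
      Polynomial.map_pow, Polynomial.map_X, Polynomial.map_ofNat]
    linear_combination (-99 * Polynomial.X ^ 4 + 23800 * Polynomial.X ^ 3 + 1779570
        * Polynomial.X ^ 2 - 1034350796 * Polynomial.X + 73592661338) * h
  have hcoeff (r₁ r₀ : ZMod 11) (h : Polynomial.C r₁ * Polynomial.X + Polynomial.C r₀ = 0) :
      r₁ = 0 ∧ r₀ = 0 :=
    ⟨by simpa using congrArg (Polynomial.coeff · 1) h,
      by simpa using congrArg (Polynomial.coeff · 0) h⟩
  have hdeg := monic_integralQuintic.natDegree_map (Int.castRingHom (ZMod 11))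
  have hm := monic_integralQuintic.map (Int.castRingHom (ZMod 11))
  rw [natDegree_integralQuintic] at hdeg
  rw [hm.irreducible_iff_lt_natDegree_lt (fun h ↦ by simp [h] at hdeg), hdeg, hmap]
  intro q hq hqd hdvd
  simp only [Finset.mem_Ioc] at hqd
  obtain h1 | h2 : q.natDegree = 1 ∨ q.natDegree = 2 := by omega
  · obtain ⟨a, rfl⟩ : ∃ a, q = Polynomial.X + Polynomial.C a := ⟨_, hq.eq_X_add_C h1⟩
    have h := eval_dvd (x := -a) hdvd
    refine hlin a ?_
    simpa using h
  · obtain ⟨u, v, rfl⟩ : ∃ u v, q = Polynomial.X ^ 2 + Polynomial.C u * Polynomial.X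
      + Polynomial.C v := by
      refine ⟨q.coeff 1, q.coeff 0, ?_⟩
      have := hq.as_sum
      rw [h2] at this
      rw [this]
      simp [Finset.sum_range_succ]
      ring
    set s : (ZMod 11)[X] := Polynomial.X ^ 3 + Polynomial.C (3 - u) * Polynomial.X ^ 2
      + Polynomial.C (7 - u * (3 - u) - v) * Polynomial.X
      + Polynomial.C (-u * (7 - u * (3 - u) - v) - v * (3 - u)) with hs
    set r₁ : ZMod 11 := 4 - u * (-u * (7 - u * (3 - u) - v) - v * (3 - u))
      - v * (7 - u * (3 - u) - v) with hr₁
    set r₀ : ZMod 11 := 2 - v * (-u * (7 - u * (3 - u) - v) - v * (3 - u)) with hr₀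
    have hrem : Polynomial.X ^ 2 + Polynomial.C u * Polynomial.X + Polynomial.C v ∣
        Polynomial.C r₁ * Polynomial.X + Polynomial.C r₀ := by
      have := dvd_sub hdvd (Dvd.intro s rfl)
      convert this using 1
      simp only [hs, hr₁, hr₀, map_sub, map_mul, map_neg, map_ofNat]
      ring
    have hz := eq_zero_of_dvd_of_natDegree_lt hrem
      (by rw [h2]; exact (natDegree_linear_le).trans_lt one_lt_two)
    obtain ⟨h₁, h₀⟩ := hcoeff _ _ hz
    exact hquad u v h₁ h₀

theorem irreducible_map_integralQuintic :
    Irreducible (integralQuintic.map (algebraMap ℤ ℚ)) :=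
  have : Fact (Nat.Prime 11) := ⟨by norm_num⟩
  monic_integralQuintic.irreducible_iff_irreducible_map_fraction_map.mp
    (monic_integralQuintic.irreducible_of_irreducible_map _ _ irreducible_integralQuintic_map)

theorem irreducible_psi : Irreducible psi := by
  have : Invertible (117 : ℚ) := invertibleOfNonzero (by norm_num)
  have h := (MulEquiv.irreducible_iff (algEquivCMulXAddC (117 : ℚ) 0)).mpr
    irreducible_map_integralQuintic
  rw [psi_eq_C_mul_comp, irreducible_isUnit_mul (isUnit_C.mpr (by norm_num))]
  simpa [algEquivCMulXAddC_apply, ← comp_eq_aeval] using h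

open NumberField

/-! ### Factorization modulo 31 -/

section Residue

variable {k : Type*} [CommRing k] {t : k}

theorem eval_map_integralQuintic (t : k) :
    (integralQuintic.map (Int.castRingHom k)).eval t = t ^ 5 - 1086 * t ^ 4 + 261807 * t ^ 3
      + 19575270 * t ^ 2 - 11377858752 * t + 809519274720 := by
  simp [integralQuintic]

theorem eval_derivative_map_integralQuintic (t : k) :
    (derivative (integralQuintic.map (Int.castRingHom k))).eval t = 5 * t ^ 4 - 4344 * t ^ 3
      + 785421 * t ^ 2 + 39150540 * t - 11377858752 := by
  simp [integralQuintic]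
  ring

variable [IsDomain k]

theorem isRoot_integralQuintic_cases (h31 : (31 : k) = 0)
    (ht : (integralQuintic.map (Int.castRingHom k)).eval t = 0) :
    t = 1 ∨ t = 13 ∨ t = 28 ∨ t ^ 2 + 10 * t + 27 = 0 := by
  rw [eval_map_integralQuintic] at ht
  have : (t - 1) * ((t - 13) * ((t - 28) * (t ^ 2 + 10 * t + 27))) = 0 := by
    linear_combination ht - (26113525308 - 367027937 * t + 631378 * t ^ 2 + 8445 * t ^ 3 - 34
        * t ^ 4) * h31
  simpa [sub_eq_zero] using this

/-- A Bézout identity modulo 31 between the quintic and its derivative excludes multiple roots. -/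
theorem nodup_roots_map_integralQuintic (h31 : (31 : k) = 0) :
    (integralQuintic.map (Int.castRingHom k)).roots.Nodup := by
  classical
  rw [Multiset.nodup_iff_count_le_one]
  intro t
  rw [count_roots]
  by_contra! h
  rw [one_lt_rootMultiplicity_iff_isRoot (monic_integralQuintic.map _).ne_zero, IsRoot.def,
    IsRoot.def, eval_map_integralQuintic, eval_derivative_map_integralQuintic] at h
  refine one_ne_zero (α := k) ?_
  linear_combination (8 + 15 * t + 21 * t ^ 2 + 7 * t ^ 3) * h.1
    + (4 + t + 3 * t ^ 2 + 6 * t ^ 3 + 11 * t ^ 4) * h.2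
    - (207440089121 + 388404677232 * t + 541783942128 * t ^ 2 + 172898279997 * t ^ 3
      - 6585458170 * t ^ 4 + 18640774 * t ^ 5 + 336240 * t ^ 6 - 1785 * t ^ 7 + 2 * t ^ 8) * h31

/-- Repeated squaring gives t³² = 27, the constant term of the quadratic. If t were fixed by the
31st power map, then t² = 27, and the quadratic would force t = 7, whose square is 18. -/
theorem pow_ne_self_of_quadratic (h31 : (31 : k) = 0) (ht : t ^ 2 + 10 * t + 27 = 0) :
    t ^ 31 ≠ t := by
  intro hpow
  have h₂ : t ^ 2 = 4 + 21 * t := by linear_combination ht - (1 + t) * h31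
  have h₄ : t ^ 4 = 13 + 5 * t := by
    linear_combination (t ^ 2 + 4 + 21 * t) * h₂ + 441 * h₂ + (57 + 304 * t) * h31
  have h₈ : t ^ 8 = 21 + 4 * t := by
    linear_combination (t ^ 4 + 13 + 5 * t) * h₄ + 25 * h₂ + (8 + 21 * t) * h31
  have h₁₆ : t ^ 16 = 9 + 8 * t := by
    linear_combination (t ^ 8 + 21 + 4 * t) * h₈ + 16 * h₂ + (16 + 16 * t) * h31
  have h₃₂ : t ^ 32 = 27 := by
    linear_combination (t ^ 16 + 9 + 8 * t) * h₁₆ + 64 * h₂ + (10 + 48 * t) * h31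
  have hsq : t ^ 2 = 27 := by linear_combination h₃₂ - t * hpow
  have h₇ : t = 7 := by linear_combination 3 * (hsq - h₂) - (2 * t - 2) * h31
  refine one_ne_zero (α := k) ?_
  linear_combination 24 * (hsq - (t + 7) * h₇) - 17 * h31

end Residue

/-! ### A transposition in the Galois group, and S₅ -/

section Swap

variable (L : Type*) [Field L] [NumberField L]

theorem isIntegral_of_mem_rootSet
    (α : (integralQuintic.map (algebraMap ℤ ℚ)).rootSet L) : IsIntegral ℤ (α : L) := by
  refine ⟨integralQuintic, monic_integralQuintic, ?_⟩
  have := aeval_eq_zero_of_mem_rootSet α.2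
  rwa [Polynomial.aeval_map_algebraMap] at this

/-- The roots of the integral quintic, as algebraic integers. -/
def integralRoot (α : (integralQuintic.map (algebraMap ℤ ℚ)).rootSet L) : 𝓞 L :=
  ⟨α, isIntegral_of_mem_rootSet L α⟩

variable [hs : Fact (((integralQuintic.map (algebraMap ℤ ℚ)).map (algebraMap ℚ L)).Splits)]

theorem map_integralQuintic_eq_prod : integralQuintic.map (Int.castRingHom (𝓞 L)) =
    ∏ α, (Polynomial.X - Polynomial.C (integralRoot L α)) := by
  apply Polynomial.map_injective (algebraMap (𝓞 L) L) RingOfIntegers.coe_injective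
  have hnd := nodup_roots ((separable_map (algebraMap ℚ L)).mpr
    irreducible_map_integralQuintic.separable)
  have h := hs.out.eq_prod_roots_of_monic ((monic_integralQuintic.map _).map _)
  have hZ : (algebraMap (𝓞 L) L).comp (Int.castRingHom (𝓞 L)) =
      (algebraMap ℚ L).comp (algebraMap ℤ ℚ) := RingHom.ext_int _ _
  rw [Polynomial.map_map, hZ, ← Polynomial.map_map, h, Polynomial.map_prod]
  simp only [Polynomial.map_sub, Polynomial.map_X, Polynomial.map_C]
  classical
  have hset : ∏ α : (integralQuintic.map (algebraMap ℤ ℚ)).rootSet L,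
      (Polynomial.X - Polynomial.C (α : L)) =
      ∏ α ∈ ((integralQuintic.map (algebraMap ℤ ℚ)).rootSet L).toFinset,
        (Polynomial.X - Polynomial.C α) := 
    Finset.prod_set_coe (f := fun α : L ↦ Polynomial.X - Polynomial.C α) _
  refine Eq.trans ?_ hset.symm
  have hf : ((integralQuintic.map (algebraMap ℤ ℚ)).rootSet L).toFinset =
      ((integralQuintic.map (algebraMap ℤ ℚ)).map (algebraMap ℚ L)).roots.toFinset := by
    ext α
    simp [rootSet_def, aroots_def]
  rw [hf, Finset.prod, Multiset.toFinset_val, hnd.dedup]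

theorem roots_map_integralQuintic (Q : Ideal (𝓞 L)) [Q.IsPrime] :
    (integralQuintic.map (Int.castRingHom (𝓞 L ⧸ Q))).roots =
      Finset.univ.val.map fun α ↦ Ideal.Quotient.mk Q (integralRoot L α) := by
  have h := congrArg (Polynomial.map (Ideal.Quotient.mk Q)) (map_integralQuintic_eq_prod L)
  rw [Polynomial.map_map, Polynomial.map_prod] at h
  have hZ : (Ideal.Quotient.mk Q).comp (Int.castRingHom (𝓞 L)) = Int.castRingHom (𝓞 L ⧸ Q) :=
    RingHom.ext_int _ _
  rw [← hZ, h]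
  simp only [Polynomial.map_sub, Polynomial.map_X, Polynomial.map_C]
  rw [← roots_multiset_prod_X_sub_C (Finset.univ.val.map _), Multiset.map_map]
  rfl

open scoped Classical in
-- The roots stay distinct modulo a prime Q over 31, so the permutation induced by Frobenius can be
-- read off from x ↦ x³¹ on the residues. It fixes the roots over 1, 13 and 28 and moves some other
-- one, so exactly two roots move.
theorem exists_isSwap_galActionHom [IsGalois ℚ L] : ∃ σ : L ≃ₐ[ℚ] L,
    (Gal.galActionHom (integralQuintic.map (algebraMap ℤ ℚ)) L (Gal.restrict _ L σ)).IsSwap := by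
  have : Fact (Nat.Prime 31) := ⟨by norm_num⟩
  obtain ⟨Q, σ, hQ, h31, hσ⟩ := exists_frobenius L 31
  replace h31 : (31 : 𝓞 L ⧸ Q) = 0 := by
    have := Ideal.Quotient.eq_zero_iff_mem.mpr h31
    rwa [map_natCast] at this
  have hcard : Fintype.card ((integralQuintic.map (algebraMap ℤ ℚ)).rootSet L) = 5 := by
    rw [card_rootSet_eq_natDegree irreducible_map_integralQuintic.separable hs.out,
      monic_integralQuintic.natDegree_map, natDegree_integralQuintic]
  set r := fun α ↦ Ideal.Quotient.mk Q (integralRoot L α) with hr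
  set τ := Gal.galActionHom (integralQuintic.map (algebraMap ℤ ℚ)) L (Gal.restrict _ L σ) with hτ
  have hroots := roots_map_integralQuintic L Q
  have hinj : Function.Injective r := by
    have := nodup_roots_map_integralQuintic h31
    rw [hroots] at this
    exact fun α β h ↦ Multiset.inj_on_of_nodup_map this α (Finset.mem_univ α) β
      (Finset.mem_univ β) h
  have hmem (a : 𝓞 L ⧸ Q) :
      (integralQuintic.map (Int.castRingHom (𝓞 L ⧸ Q))).eval a = 0 ↔ ∃ α, r α = a := by
    rw [← IsRoot.def, ← mem_roots (monic_integralQuintic.map _).ne_zero, hroots]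
    simp [hr]
  have hfrob (α) : r (τ α) = r α ^ 31 :=
    hσ _ _ (Gal.galActionHom_restrict _ _ σ α)
  have hfix {α} : τ α = α ↔ r α ^ 31 = r α := by
    rw [← hfrob, hinj.eq_iff]
  obtain ⟨α₁, h₁⟩ := (hmem 1).mp (by
    rw [eval_map_integralQuintic]; linear_combination 25747137160 * h31)
  obtain ⟨α₂, h₂⟩ := (hmem 13).mp (by
    rw [eval_map_integralQuintic]; linear_combination 21466447600 * h31)
  obtain ⟨α₃, h₃⟩ := (hmem 28).mp (by
    rw [eval_map_integralQuintic]; linear_combination 16496229760 * h31)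
  have hthree : Finset.card {α₁, α₂, α₃} = 3 := by
    have hone : (1 : 𝓞 L ⧸ Q) ≠ 0 := one_ne_zero
    refine Finset.card_eq_three.mpr ⟨α₁, α₂, α₃, ?_, ?_, ?_, rfl⟩ <;> rintro rfl <;>
      refine hone ?_
    · linear_combination 13 * (h₁ - h₂) - 5 * h31
    · linear_combination 23 * (h₁ - h₃) - 20 * h31
    · linear_combination h31 - 2 * (h₂ - h₃)
  refine ⟨σ, ?_⟩
  rw [← Equiv.Perm.card_support_eq_two]
  apply le_antisymm
  · have hsub : τ.support ⊆ Finset.univ \ {α₁, α₂, α₃} := by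
      intro α hα
      rw [Finset.mem_sdiff, and_iff_right (Finset.mem_univ α)]
      intro h
      refine Equiv.Perm.mem_support.mp hα (hfix.mpr ?_)
      simp only [Finset.mem_insert, Finset.mem_singleton] at h
      rcases h with rfl | rfl | rfl
      · rw [h₁, one_pow]
      · rw [h₂]
        linear_combination 1098707850562880144675715116994504 * h31
      · rw [h₃]
        linear_combination 23471307205875422096232146148963220219392924 * h31
    refine (Finset.card_le_card hsub).trans ?_
    rw [Finset.card_sdiff_of_subset (Finset.subset_univ _), Finset.card_univ, hcard,
      hthree]
  · refine Equiv.Perm.two_le_card_support_of_ne_one ?_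
    obtain ⟨β, -, hβ⟩ := Finset.exists_mem_notMem_of_card_lt_card
      (s := {α₁, α₂, α₃}) (t := Finset.univ) (by rw [hthree, Finset.card_univ, hcard]; norm_num)
    simp only [Finset.mem_insert, Finset.mem_singleton, not_or] at hβ
    intro hone
    have hroot := isRoot_integralQuintic_cases h31 ((hmem (r β)).mpr ⟨β, rfl⟩)
    rw [← h₁, ← h₂, ← h₃, hinj.eq_iff, hinj.eq_iff, hinj.eq_iff] at hroot
    refine pow_ne_self_of_quadratic h31 (hroot.resolve_left hβ.1 |>.resolve_left hβ.2.1
      |>.resolve_left hβ.2.2) (hfix.mp ?_)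
    exact Equiv.ext_iff.mp hone β

end Swap

/-- Irreducibility makes the prime degree 5 divide the order of the group; together with a
transposition this yields all permutations of the roots. -/
theorem bijective_galActionHom_integralQuintic (L : Type*) [Field L] [NumberField L]
    [hL : IsSplittingField ℚ L (integralQuintic.map (algebraMap ℤ ℚ))]
    [hs : Fact (((integralQuintic.map (algebraMap ℤ ℚ)).map (algebraMap ℚ L)).Splits)] :
    Function.Bijective (Gal.galActionHom (integralQuintic.map (algebraMap ℤ ℚ)) L) := by
  classical
  have hsep := irreducible_map_integralQuintic.separable
  have hdeg : (integralQuintic.map (algebraMap ℤ ℚ)).natDegree = 5 := by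
    rw [monic_integralQuintic.natDegree_map, natDegree_integralQuintic]
  have : IsGalois ℚ L := IsGalois.of_separable_splitting_field hsep
  have hcard : Fintype.card ((integralQuintic.map (algebraMap ℤ ℚ)).rootSet L) = 5 := by
    rw [card_rootSet_eq_natDegree hsep hs.out, hdeg]
  have hinj := Gal.galActionHom_injective (integralQuintic.map (algebraMap ℤ ℚ)) L
  obtain ⟨σ, hσ⟩ := exists_isSwap_galActionHom L
  refine ⟨hinj, MonoidHom.range_eq_top.mp ?_⟩
  apply Equiv.Perm.subgroup_eq_top_of_swap_mem (by rw [hcard]; norm_num) _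
    (MonoidHom.mem_range.mpr ⟨_, rfl⟩) hσ
  rw [hcard, ← hdeg]
  simpa only [Fintype.card_eq_nat_card,
    Nat.card_congr (MonoidHom.ofInjective hinj).toEquiv.symm]
    using Gal.prime_degree_dvd_card irreducible_map_integralQuintic (by rw [hdeg]; norm_num)

theorem nonempty_gal_map_integralQuintic_mulEquiv :
    Nonempty ((integralQuintic.map (algebraMap ℤ ℚ)).Gal ≃* Equiv.Perm (Fin 5)) := by
  have : NumberField (integralQuintic.map (algebraMap ℤ ℚ)).SplittingField :=
    { to_charZero := inferInstance, to_finiteDimensional := inferInstance }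
  have hsplit : IsSplittingField ℚ (integralQuintic.map (algebraMap ℤ ℚ)).SplittingField
      (integralQuintic.map (algebraMap ℤ ℚ)) := by
    convert! IsSplittingField.splittingField (integralQuintic.map (algebraMap ℤ ℚ))
  have : Fact (((integralQuintic.map (algebraMap ℤ ℚ)).map
      (algebraMap ℚ (integralQuintic.map (algebraMap ℤ ℚ)).SplittingField)).Splits) :=
    ⟨hsplit.splits⟩
  have hcard : Fintype.card ((integralQuintic.map (algebraMap ℤ ℚ)).rootSet
      (integralQuintic.map (algebraMap ℤ ℚ)).SplittingField) = 5 := by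
    rw [card_rootSet_eq_natDegree irreducible_map_integralQuintic.separable
      hsplit.splits, monic_integralQuintic.natDegree_map, natDegree_integralQuintic]
  exact ⟨(MulEquiv.ofBijective _ (bijective_galActionHom_integralQuintic
    (integralQuintic.map (algebraMap ℤ ℚ)).SplittingField)).trans
    (Fintype.equivFinOfCardEq hcard).permCongrHom⟩

theorem nonempty_gal_psi_mulEquiv : Nonempty (psi.Gal ≃* Equiv.Perm (Fin 5)) := by
  obtain ⟨φ⟩ := nonempty_gal_map_integralQuintic_mulEquiv
  obtain ⟨χ⟩ := Gal.nonempty_mulEquiv_C_mul_comp_C_mul_X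
    (integralQuintic.map (algebraMap ℤ ℚ)) (u := 1 / 117 ^ 5) (c := 117) (by norm_num)
    (by norm_num)
  rw [psi_eq_C_mul_comp]
  exact ⟨χ.trans φ⟩

theorem not_mem_solvableByRad {E : Type*} [Field E] [Algebra ℚ E] {z : E}
    (hz : aeval z psi = 0) : z ∉ solvableByRad ℚ E := by
  intro h
  obtain ⟨φ⟩ := nonempty_gal_psi_mulEquiv
  have := isSolvable_gal_of_irreducible h irreducible_psi hz
  exact Equiv.Perm.not_isSolvable_fin_5
    (Group.isSolvable_of_surjective (f := φ.toMonoidHom) φ.surjective)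

end FourCycle

/-! ### Real roots and the positive solution -/

namespace FourCycle

theorem aeval_psi_real (x : ℝ) : Polynomial.aeval x psi = (351 * x ^ 5 - 3258 * x ^ 4
    + 6713 * x ^ 3 + 4290 * x ^ 2 - 21312 * x + 12960) / 351 := by
  simp [psi]
  ring

theorem exists_root_psi_of_sign {u v : ℝ} (huv : u ≤ v)
    (h : Polynomial.aeval u psi ≤ 0 ∧ 0 ≤ Polynomial.aeval v psi ∨
      Polynomial.aeval v psi ≤ 0 ∧ 0 ≤ Polynomial.aeval u psi) :
    ∃ x, u ≤ x ∧ x ≤ v ∧ Polynomial.aeval x psi = 0 := by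
  have hc : ContinuousOn (fun x : ℝ ↦ Polynomial.aeval x psi) (Set.Icc u v) :=
    (Polynomial.continuous_aeval psi).continuousOn
  rcases h with h | h
  · obtain ⟨x, hx, hx0⟩ := intermediate_value_Icc huv hc h
    exact ⟨x, hx.1, hx.2, hx0⟩
  · obtain ⟨x, hx, hx0⟩ := intermediate_value_Icc' huv hc h
    exact ⟨x, hx.1, hx.2, hx0⟩

/-- Five sign changes on disjoint intervals exhaust the degree. The brackets for the middle three
roots are narrow enough to determine later the range of k. -/
theorem exists_rootSet_psi_real : ∃ r₁ r₂ r₃ r₄ r₅ : ℝ,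
    psi.rootSet ℝ = {r₁, r₂, r₃, r₄, r₅} ∧ (psi.rootSet ℝ).ncard = 5 ∧ r₁ ≤ -1 ∧
      (0.94 ≤ r₂ ∧ r₂ ≤ 0.95) ∧ (1.7575 ≤ r₃ ∧ r₃ ≤ 1.7585) ∧ (2.22 ≤ r₄ ∧ r₄ ≤ 2.24) ∧
      6 ≤ r₅ := by
  obtain ⟨r₁, -, h₁, e₁⟩ := exists_root_psi_of_sign (u := -2) (v := -1) (by norm_num)
    (by simp only [aeval_psi_real]; norm_num)
  obtain ⟨r₂, h₂, h₂', e₂⟩ := exists_root_psi_of_sign (u := 0.94) (v := 0.95) (by norm_num)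
    (by simp only [aeval_psi_real]; norm_num)
  obtain ⟨r₃, h₃, h₃', e₃⟩ := exists_root_psi_of_sign (u := 1.7575) (v := 1.7585) (by norm_num)
    (by simp only [aeval_psi_real]; norm_num)
  obtain ⟨r₄, h₄, h₄', e₄⟩ := exists_root_psi_of_sign (u := 2.22) (v := 2.24) (by norm_num)
    (by simp only [aeval_psi_real]; norm_num)
  obtain ⟨r₅, h₅, -, e₅⟩ := exists_root_psi_of_sign (u := 6) (v := 7) (by norm_num)
    (by simp only [aeval_psi_real]; norm_num)
  have hdeg : psi.natDegree = 5 := by unfold psi; compute_degree!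
  have hle : (psi.rootSet ℝ).ncard ≤ 5 := hdeg ▸ psi.ncard_rootSet_le ℝ
  have hcard : ({r₁, r₂, r₃, r₄, r₅} : Set ℝ).ncard = 5 := by
    have h12 : r₁ < r₂ := by linarith
    have h23 : r₂ < r₃ := by linarith
    have h34 : r₃ < r₄ := by linarith
    have h45 : r₄ < r₅ := by linarith
    have : ({r₁, r₂, r₃, r₄, r₅} : Set ℝ) = (({r₁, r₂, r₃, r₄, r₅} : Finset ℝ) : Set ℝ) := by
      simp
    rw [this, Set.ncard_coe_finset]
    iterate 4 rw [Finset.card_insert_of_notMem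
      (by simp only [Finset.mem_insert, Finset.mem_singleton, not_or]; grind)]
    rw [Finset.card_singleton]
  have hsub : ({r₁, r₂, r₃, r₄, r₅} : Set ℝ) ⊆ psi.rootSet ℝ := by
    have hm {r : ℝ} (hr : Polynomial.aeval r psi = 0) : r ∈ psi.rootSet ℝ :=
      Polynomial.mem_rootSet.mpr ⟨irreducible_psi.ne_zero, hr⟩
    simp only [Set.insert_subset_iff, Set.singleton_subset_iff]
    exact ⟨hm e₁, hm e₂, hm e₃, hm e₄, hm e₅⟩
  have heq := Set.eq_of_subset_of_ncard_le hsub (by rw [hcard]; exact hle)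
    (Polynomial.rootSet_finite psi ℝ)
  exact ⟨r₁, r₂, r₃, r₄, r₅, heq.symm, by rw [← heq, hcard], h₁, ⟨h₂, h₂'⟩, ⟨h₃, h₃'⟩, ⟨h₄, h₄'⟩,
    h₅⟩

/-- The system of likelihood equations for a vector of cell counts. -/
def IsSolution (v : Fin 12 → ℝ) : Prop :=
  LikelihoodEqs (v 0) (v 1) (v 2) (v 3) (v 4) (v 5) (v 6) (v 7) (v 8) (v 9) (v 10) (v 11)

theorem forall_aeval_mleIdeal_eq_zero_iff (v : Fin 12 → ℝ) :
    (∀ F ∈ mleIdeal, aeval v F = 0) ↔ IsSolution v := by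
  rw [forall_mem_mleIdeal_iff]
  simp [IsSolution, a, b, c, d, e, f, g, h, i, j, k, l]

theorem isSolution_iff (v : Fin 12 → ℝ) : IsSolution v ↔
    TriangularEqs (v 0) (v 1) (v 2) (v 3) (v 4) (v 5) (v 6) (v 7) (v 8) (v 9) (v 10) (v 11) :=
  likelihoodEqs_iff_triangularEqs ..

theorem IsSolution.aeval_psi {v : Fin 12 → ℝ} (hv : IsSolution v) :
    Polynomial.aeval (v 11) psi = 0 := by
  rw [isSolution_iff] at hv
  rw [aeval_psi_real, hv.1, zero_div]

theorem IsSolution.eq_of_eq {v w : Fin 12 → ℝ} (hv : IsSolution v) (hw : IsSolution w)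
    (h : v 11 = w 11) : v = w := by
  rw [isSolution_iff] at hv hw
  obtain ⟨-, v10, v9, v8, v7, v6, v5, v4, v3, v2, v1, v0⟩ := hv
  obtain ⟨-, w10, w9, w8, w7, w6, w5, w4, w3, w2, w1, w0⟩ := hw
  rw [h] at v10 v9 v8 v7 v5 v3 v1
  have e10 : v 10 = w 10 := by linarith
  rw [e10] at v8 v7 v5 v2 v0
  have e7 : v 7 = w 7 := by linarith
  rw [e7] at v6 v5 v4 v3 v0
  have e5 : v 5 = w 5 := by linarith
  funext n
  fin_cases n <;> simp only [Fin.zero_eta, Fin.mk_one, Fin.reduceFinMk] <;> linarith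

theorem pow_bounds {x u v : ℝ} (hu : 0 ≤ u) (hux : u ≤ x) (hxv : x ≤ v) :
    u ^ 2 ≤ x ^ 2 ∧ x ^ 2 ≤ v ^ 2 ∧ u ^ 3 ≤ x ^ 3 ∧ x ^ 3 ≤ v ^ 3 ∧ u ^ 4 ≤ x ^ 4 ∧
      x ^ 4 ≤ v ^ 4 := by
  have hx := hu.trans hux
  refine ⟨?_, ?_, ?_, ?_, ?_, ?_⟩ <;> gcongr

theorem exists_pos_solution : ∃ v : Fin 12 → ℝ, IsSolution v ∧ (∀ n, 0 < v n) ∧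
    ∀ w, IsSolution w → (∀ n, 0 ≤ w n) → w = v := by
  obtain ⟨r₁, r₂, r₃, r₄, r₅, hr, -, h₁, ⟨h₂, h₂'⟩, ⟨h₃, h₃'⟩, ⟨h₄, h₄'⟩, h₅⟩ :=
    exists_rootSet_psi_real
  have hpsi {x : ℝ} : Polynomial.aeval x psi = 0 ↔
      x = r₁ ∨ x = r₂ ∨ x = r₃ ∨ x = r₄ ∨ x = r₅ := by
    have : x ∈ psi.rootSet ℝ ↔ Polynomial.aeval x psi = 0 :=
      Polynomial.mem_rootSet_of_ne irreducible_psi.ne_zero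
    rw [← this, hr]
    simp
  obtain ⟨v, hv, hv11, hpos⟩ : ∃ v : Fin 12 → ℝ, IsSolution v ∧ v 11 = r₃ ∧ ∀ n, 0 < v n := by
    have hl := hpsi.mpr (Or.inr (Or.inr (Or.inl rfl)))
    rw [aeval_psi_real, div_eq_zero_iff, or_iff_left (by norm_num)] at hl
    generalize r₃ = l at *
    obtain ⟨k, hk⟩ : ∃ k : ℝ, k = -(176553 * l ^ 4 - 1061730 * l ^ 3 - 513737 * l ^ 2
      + 2942682 * l - 126360) / 602208 := ⟨_, rfl⟩
    obtain ⟨h, hh⟩ : ∃ h : ℝ, h = -(2 * k ^ 2 - k * l + 4 * k - 3 * l ^ 2 + l - 14) / 16 :=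
      ⟨_, rfl⟩
    obtain ⟨l₂, l₂', l₃, l₃', l₄, l₄'⟩ := pow_bounds (by norm_num) h₃ h₃'
    norm_num at l₂ l₂' l₃ l₃' l₄ l₄'
    -- Bounding the powers of l separately is enough here because the bracket of r₃ has width 0.001.
    have hk₁ : 1.01 ≤ k := by rw [hk]; linarith
    have hk₂ : k ≤ 1.06 := by rw [hk]; linarith
    have hh₁ : 1.02 ≤ h := by rw [hh]; nlinarith
    have hh₂ : h ≤ 1.1 := by rw [hh]; nlinarith
    refine ⟨![2 * h + 2 * k - 3 * l + 2 + k - 1, l - (2 * h + 2 * k - 3 * l + 2), 1 + h - k,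
      4 - h - l, 2 - (2 * h + 2 * k - 3 * l + 2), 2 * h + 2 * k - 3 * l + 2, 2 - h, h, 2 - k,
      3 - l, k, l], ?_, rfl, ?_⟩
    · rw [isSolution_iff]
      refine ⟨?_, ?_, ?_, ?_, ?_, ?_, ?_, ?_, ?_, ?_, ?_, ?_⟩ <;> simp
      · linear_combination hl
      · rw [hk]; ring
      · ring
      · rw [hh]; ring
      all_goals ring
    · intro n
      fin_cases n <;> simp <;> linarith
  refine ⟨v, hv, hpos, fun w hw hw0 ↦ hw.eq_of_eq hv ?_⟩
  rw [hv11]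
  have hw' := (isSolution_iff w).mp hw
  have hj := hw'.2.2.1
  have hi := hw'.2.2.2.1
  have hk := hw'.2.1
  have h8 := hw0 8
  have h9 := hw0 9
  have h10 := hw0 10
  have h11 := hw0 11
  have hi' : w 10 ≤ 2 := by linarith
  -- The other roots violate a sign: l < 0 at r₁, k < 0 at r₂, i = 2 - k < 0 at r₄, and j = 3 - l <
  -- 0 at r₅.
  rcases hpsi.mp hw.aeval_psi with h | h | h | h | h
  · linarith
  · exfalso
    rw [h] at hk
    obtain ⟨l₂, l₂', l₃, l₃', l₄, l₄'⟩ := pow_bounds (by norm_num) h₂ h₂'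
    norm_num at l₂ l₂' l₃ l₃' l₄ l₄'
    linarith
  · exact h
  · exfalso
    rw [h] at hk
    obtain ⟨l₂, l₂', l₃, l₃', l₄, l₄'⟩ := pow_bounds (by norm_num) h₄ h₄'
    norm_num at l₂ l₂' l₃ l₃' l₄ l₄'
    linarith
  · linarith

/-- One real zero of I suffices: its last coordinate has ψ, up to a constant factor, as minimal
polynomial, and every element of the elimination ideal vanishes there. -/
theorem comap_inclL_mleIdeal : mleIdeal.comap inclL = Ideal.span {psi} := by
  ext q
  rw [Ideal.mem_comap, Ideal.mem_span_singleton]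
  constructor
  · intro hq
    obtain ⟨v, hv, -⟩ := exists_pos_solution
    have h0 := (forall_aeval_mleIdeal_eq_zero_iff v).mpr hv _ hq
    rw [inclL, ← Polynomial.aeval_algHom_apply, l, aeval_X] at h0
    have h := minpoly.eq_of_irreducible irreducible_psi hv.aeval_psi
    exact (Dvd.intro _ h).trans (minpoly.dvd ℚ _ h0)
  · rintro ⟨w, rfl⟩
    rw [map_mul, ← span_lexBasis]
    exact Ideal.mul_mem_right _ _ (Ideal.subset_span ((Set.ext_iff.mp setOf_inclL_mem_lexBasis
      psi).mpr rfl))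

/-! ### The likelihood on the extended model -/

theorem sum_cell (q : Cell → ℝ) : ∑ x, q x = ∑ n, q (cell n) +
    (q (1, 1, 0, 0) + q (1, 1, 0, 1) + q (1, 1, 1, 0) + q (1, 1, 1, 1)) := by
  simp [Fintype.sum_prod_type, Fin.sum_univ_succ, cell]
  ring

theorem likelihood_eq_prod (q : Cell → ℝ) :
    likelihood q = ∏ n, q (cell n) ^ counts (cell n) := by
  simp [likelihood, Fintype.prod_prod_type, Fin.prod_univ_succ, cell, counts]
  ring

theorem sum_counts : ∑ x, counts x = 13 := by decide

theorem counts_cell_pos (n : Fin 12) : 0 < counts (cell n) := by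
  revert n; decide

/-- The quadratic binomials of the simplified four-cycle model. -/
def Binomials (v : Fin 12 → ℝ) : Prop :=
  v 2 * v 7 = v 3 * v 6 ∧ v 1 * v 11 = v 3 * v 9 ∧ v 0 * v 10 = v 2 * v 8 ∧ v 0 * v 5 = v 1 * v 4

/-- Only these closed conditions on limits are needed for the upper bound on the likelihood. -/
theorem extendedModel_subset : extendedModel ⊆
    {q | (∀ x, 0 ≤ q x) ∧ ∑ x, q x = 1 ∧ Binomials fun n ↦ q (cell n)} := by
  refine closure_minimal ?_ ?_
  · rintro q ⟨⟨hq0, hq1⟩, t₁₂, t₂₃, t₃₄, t₁₄, ht⟩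
    refine ⟨hq0, hq1, ?_⟩
    simp only [Binomials, cell, Matrix.cons_val, ht]
    refine ⟨?_, ?_, ?_, ?_⟩ <;> ring
  · simp only [Binomials, Set.ofPred_and, Set.ofPred_forall]
    refine (isClosed_iInter fun x ↦ isClosed_le continuous_const (continuous_apply x)).inter
      ((isClosed_eq (by fun_prop) continuous_const).inter ?_)
    refine (isClosed_eq ?_ ?_).inter ((isClosed_eq ?_ ?_).inter
      ((isClosed_eq ?_ ?_).inter (isClosed_eq ?_ ?_))) <;> fun_prop

/-- The table with the entries of `v` in the first twelve cells, and zeros in the cells `11kl`. -/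
def table (v : Fin 12 → ℝ) (x : Cell) : ℝ :=
  ![![![![v 0, v 1], ![v 2, v 3]], ![![v 4, v 5], ![v 6, v 7]]],
    ![![![v 8, v 9], ![v 10, v 11]], ![![0, 0], ![0, 0]]]] x.1 x.2.1 x.2.2.1 x.2.2.2

theorem table_cell (v : Fin 12 → ℝ) (n : Fin 12) : table v (cell n) = v n := by
  fin_cases n <;> rfl

theorem table_one_one (v : Fin 12 → ℝ) (x₃ x₄ : Fin 2) : table v (1, 1, x₃, x₄) = 0 := by
  fin_cases x₃ <;> fin_cases x₄ <;> rfl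

/-- The potential on the first edge vanishes at (1, 1), the one on the third is the slice 00kl, and
the other two are ratios to that slice. The table thus lies in the model itself, not only in its
closure. -/
theorem factors_table {v : Fin 12 → ℝ} (hv : ∀ n, 0 < v n) (hb : Binomials v) :
    Factors (table v) := by
  lift v to Fin 12 → NNReal using fun n ↦ (hv n).le
  simp only [Binomials, NNReal.coe_pos] at hv hb
  obtain ⟨h₁, h₂, h₃, h₄⟩ := hb
  refine ⟨![![1, 1], ![1, 0]], ![![1, 1], ![v 4 / v 0, v 6 / v 2]], ![![v 0, v 1], ![v 2, v 3]],
    ![![1, 1], ![v 8 / v 0, v 9 / v 1]], fun x₁ x₂ x₃ x₄ ↦ ?_⟩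
  have hv' (n) : (v n : ℝ) ≠ 0 := (NNReal.coe_pos.mpr (hv n)).ne'
  fin_cases x₁ <;> fin_cases x₂ <;> fin_cases x₃ <;> fin_cases x₄ <;> simp [table] <;>
    field_simp [hv'] <;> linarith

/-- The linear equations say that the counts and v have equal clique marginals, so their difference
is a combination of the exponent vectors of the four binomials, and these are orthogonal to log q.
-/
theorem log_likelihood {v : Fin 12 → ℝ} (hv : IsSolution v) {q : Cell → ℝ}
    (hq : ∀ n, 0 < q (cell n)) (hb : Binomials fun n ↦ q (cell n)) :
    Real.log (likelihood q) = ∑ n, v n * Real.log (q (cell n)) := by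
  rw [likelihood_eq_prod, Real.log_prod (fun n _ ↦ (pow_pos (hq n) _).ne')]
  simp only [Real.log_pow]
  obtain ⟨b₁, b₂, b₃, b₄⟩ := hb
  have lg {i j k m : Fin 12} (h : q (cell i) * q (cell j) = q (cell k) * q (cell m)) :
      Real.log (q (cell i)) + Real.log (q (cell j)) =
        Real.log (q (cell k)) + Real.log (q (cell m)) := by
    rw [← Real.log_mul (hq _).ne' (hq _).ne', h, Real.log_mul (hq _).ne' (hq _).ne']
  replace b₁ := lg b₁
  replace b₂ := lg b₂
  replace b₃ := lg b₃
  replace b₄ := lg b₄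
  obtain ⟨L, hL⟩ : ∃ L : Fin 12 → ℝ, ∀ n, Real.log (q (cell n)) = L n := ⟨_, fun _ ↦ rfl⟩
  simp only [hL] at b₁ b₂ b₃ b₄ ⊢
  have hc (n) : (counts (cell n) : ℝ) = (![1, 1, 1, 1, 1, 1, 1, 1, 1, 1, 1, 2] : Fin 12 → ℝ) n := by
    fin_cases n <;> simp [cell, counts]
  obtain ⟨-, -, -, -, -, s₁, s₂, s₃, s₄, s₅, s₆, s₇, s₈⟩ := hv
  have e₀ : v 0 - v 5 - v 10 = -1 := by linarith
  have e₁ : v 1 + v 5 - v 11 = 0 := by linarith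
  have e₂ : v 2 - v 7 + v 10 = 1 := by linarith
  have e₃ : v 3 + v 7 + v 11 = 4 := by linarith
  have e₄ : v 4 + v 5 = 2 := by linarith
  have e₆ : v 6 + v 7 = 2 := by linarith
  have e₈ : v 8 + v 10 = 2 := by linarith
  have e₉ : v 9 + v 11 = 3 := by linarith
  simp only [hc, Fin.sum_univ_succ, Fin.sum_univ_zero]
  simp
  -- Each of the cells 5, 7, 10, 11 occurs in exactly one binomial, so the weight of that binomial
  -- is the count minus v in that cell.
  linear_combination (1 - v 5) * b₄ + (1 - v 7) * b₁ + (1 - v 10) * b₃ + (2 - v 11) * b₂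
    - L 0 * e₀ - L 1 * e₁ - L 2 * e₂ - L 3 * e₃ - L 4 * e₄ - L 6 * e₆ - L 8 * e₈ - L 9 * e₉

theorem IsSolution.binomials {v : Fin 12 → ℝ} (hv : IsSolution v) (s : ℝ) :
    Binomials fun n ↦ v n / s := by
  obtain ⟨h₁, h₂, h₃, h₄, -⟩ := hv
  refine ⟨?_, ?_, ?_, ?_⟩
  · linear_combination (1 / s ^ 2) * h₁
  · linear_combination (1 / s ^ 2) * h₂
  · linear_combination (1 / s ^ 2) * h₃
  · linear_combination (1 / s ^ 2) * h₄

theorem IsSolution.sum_eq {v : Fin 12 → ℝ} (hv : IsSolution v) : ∑ n, v n = 13 := by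
  obtain ⟨-, -, -, -, -, s₁, s₂, s₃, -⟩ := hv
  simp [Fin.sum_univ_succ]
  linarith

theorem table_mem_model {v : Fin 12 → ℝ} (hv : IsSolution v) (hpos : ∀ n, 0 < v n) :
    table (fun n ↦ v n / 13) ∈ model := by
  refine ⟨⟨?_, ?_⟩, factors_table (fun n ↦ div_pos (hpos n) (by norm_num)) (hv.binomials 13)⟩
  · rintro ⟨x₁, x₂, x₃, x₄⟩
    fin_cases x₁ <;> fin_cases x₂ <;> fin_cases x₃ <;> fin_cases x₄ <;>
      simp [table] <;> exact div_nonneg (hpos _).le (by norm_num)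
  · simp only [sum_cell, table_cell, table_one_one, ← Finset.sum_div, hv.sum_eq]
    norm_num

theorem eq_table_of_sum_eq_one {p : Fin 12 → ℝ} (hp : ∑ n, p n = 1) {q : Cell → ℝ}
    (hq : ∀ x, 0 ≤ q x) (hq1 : ∑ x, q x = 1) (h : ∀ n, q (cell n) = p n) : q = table p := by
  rw [sum_cell] at hq1
  simp only [h, hp] at hq1
  have h₀ := hq (1, 1, 0, 0)
  have h₁ := hq (1, 1, 0, 1)
  have h₂ := hq (1, 1, 1, 0)
  have h₃ := hq (1, 1, 1, 1)
  funext x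
  by_cases hx : ∃ n, cell n = x
  · obtain ⟨n, rfl⟩ := hx
    rw [h, table_cell]
  · obtain ⟨x₃, x₄, rfl⟩ : ∃ x₃ x₄, x = (1, 1, x₃, x₄) := by
      revert x
      decide
    rw [table_one_one]
    fin_cases x₃ <;> fin_cases x₄ <;> simp <;> linarith

/-- Gibbs' inequality: log x ≤ x - 1 bounds the difference of log-likelihoods by 13 ∑ q - 13 over
the twelve cells, which is at most 0. Strictness comes from a cell where q differs from v/13; if
none existed, no mass would be left for the cells 11kl. A zero in one of the twelve cells makes the
likelihood zero. -/
theorem likelihood_lt {v : Fin 12 → ℝ} (hv : IsSolution v) (hpos : ∀ n, 0 < v n) {q : Cell → ℝ}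
    (hq : q ∈ extendedModel) (hne : q ≠ table fun n ↦ v n / 13) :
    likelihood q < likelihood (table fun n ↦ v n / 13) := by
  obtain ⟨hq0, hq1, hb⟩ := extendedModel_subset hq
  set p : Fin 12 → ℝ := fun n ↦ v n / 13 with hp
  have hppos (n) : 0 < p n := div_pos (hpos n) (by norm_num)
  have hLp : 0 < likelihood (table p) := by
    rw [likelihood_eq_prod]
    exact Finset.prod_pos fun n _ ↦ pow_pos (by rw [table_cell]; exact hppos n) _
  by_cases hqpos : ∀ n, 0 < q (cell n)
  · have hLq : 0 < likelihood q := by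
      rw [likelihood_eq_prod]
      exact Finset.prod_pos fun n _ ↦ pow_pos (hqpos n) _
    have hpb : Binomials fun n ↦ table p (cell n) := by
      simpa only [table_cell] using hv.binomials 13
    rw [← Real.log_lt_log_iff hLq hLp, log_likelihood hv hqpos hb,
      log_likelihood hv (fun n ↦ by rw [table_cell]; exact hppos n) hpb, ← sub_neg,
      ← Finset.sum_sub_distrib]
    simp only [table_cell]
    have hterm (n) : v n * Real.log (q (cell n)) - v n * Real.log (p n) =
        v n * Real.log (q (cell n) / p n) := by
      rw [Real.log_div (hqpos n).ne' (hppos n).ne', mul_sub]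
    have hval (n) : v n * (q (cell n) / p n - 1) = 13 * q (cell n) - v n := by
      have := (hpos n).ne'
      simp only [hp]
      field_simp
    have hlt (n) (h : q (cell n) ≠ p n) :
        v n * Real.log (q (cell n)) - v n * Real.log (p n) < 13 * q (cell n) - v n := by
      rw [hterm, ← hval]
      refine mul_lt_mul_of_pos_left (Real.log_lt_sub_one_of_pos (div_pos (hqpos n) (hppos n)) ?_)
        (hpos n)
      rwa [Ne, div_eq_one_iff_eq (hppos n).ne']
    have hle (n) : v n * Real.log (q (cell n)) - v n * Real.log (p n) ≤
        13 * q (cell n) - v n := by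
      rw [hterm, ← hval]
      exact mul_le_mul_of_nonneg_left (Real.log_le_sub_one_of_pos (div_pos (hqpos n) (hppos n)))
        (hpos n).le
    obtain ⟨m, hm⟩ : ∃ n, q (cell n) ≠ p n := by
      by_contra! h
      refine hne (eq_table_of_sum_eq_one ?_ hq0 hq1 h)
      rw [hp, ← Finset.sum_div, hv.sum_eq]
      norm_num
    refine (Finset.sum_lt_sum (fun n _ ↦ hle n) ⟨m, Finset.mem_univ m, hlt m hm⟩).trans_le ?_
    rw [Finset.sum_sub_distrib, ← Finset.mul_sum, hv.sum_eq]
    rw [sum_cell] at hq1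
    linarith [hq0 (1, 1, 0, 0), hq0 (1, 1, 0, 1), hq0 (1, 1, 1, 0), hq0 (1, 1, 1, 1)]
  · push Not at hqpos
    obtain ⟨n, hn⟩ := hqpos
    have h0 : likelihood q = 0 := by
      rw [likelihood_eq_prod]
      refine Finset.prod_eq_zero (Finset.mem_univ n) ?_
      rw [le_antisymm hn (hq0 _), zero_pow (counts_cell_pos n).ne']
    rwa [h0]

theorem isMLE_iff {v : Fin 12 → ℝ} (hv : IsSolution v) (hpos : ∀ n, 0 < v n) (q : Cell → ℝ) :
    IsMLE q ↔ q = table fun n ↦ v n / 13 := by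
  have hmem : table (fun n ↦ v n / 13) ∈ extendedModel := subset_closure (table_mem_model hv hpos)
  constructor
  · rintro ⟨hq, hmax⟩
    by_contra hne
    exact (likelihood_lt hv hpos hq hne).not_ge (hmax hmem)
  · rintro rfl
    refine ⟨hmem, fun q hq ↦ ?_⟩
    by_cases h : q = table fun n ↦ v n / 13
    · exact (congrArg likelihood h).le
    · exact (likelihood_lt hv hpos hq h).le

end FourCycle

theorem proposition3 :
    -- the lexicographic Gröbner basis (with a > b > ⋯ > l) of the likelihood equations
    FourCycle.IsGroebnerBasis MonomialOrder.lex FourCycle.lexBasis FourCycle.mleIdeal ∧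
    -- its only member in the single variable l is ψ, which generates the elimination ideal
    {q : Polynomial ℚ | FourCycle.inclL q ∈ FourCycle.lexBasis} = {FourCycle.psi} ∧
    FourCycle.mleIdeal.comap FourCycle.inclL = Ideal.span {FourCycle.psi} ∧
    -- ψ is irreducible over ℚ with Galois group S₅
    Irreducible FourCycle.psi ∧
    Nonempty (FourCycle.psi.Gal ≃* Equiv.Perm (Fin 5)) ∧
    -- ψ has five real roots, and no root is expressible by radicals
    (FourCycle.psi.rootSet ℝ).ncard = 5 ∧
    (∀ z : ℂ, Polynomial.aeval z FourCycle.psi = 0 → z ∉ solvableByRad ℚ ℂ) ∧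
    -- the MLE exists and is unique, and has zeros in the cells 11kl
    ∃ p : FourCycle.Cell → ℝ, (∀ q, FourCycle.IsMLE q ↔ q = p) ∧
      (∀ x₃ x₄ : Fin 2, p (1, 1, x₃, x₄) = 0) ∧
      -- its other cell counts are the only nonnegative real solution of the likelihood equations
      (∀ v : Fin 12 → ℝ,
        ((∀ n, 0 ≤ v n) ∧ ∀ F ∈ FourCycle.mleIdeal, MvPolynomial.aeval v F = 0) ↔
          v = fun n => FourCycle.estCount p (FourCycle.cell n)) ∧
      -- its count in the cell 1011 is a root of ψ, irrational, and not expressible by radicals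
      Polynomial.aeval (FourCycle.estCount p (1, 0, 1, 1)) FourCycle.psi = 0 ∧
      Irrational (FourCycle.estCount p (1, 0, 1, 1)) ∧
      (FourCycle.estCount p (1, 0, 1, 1) : ℂ) ∉ solvableByRad ℚ ℂ := by
  obtain ⟨-, -, -, -, -, -, hncard, -⟩ := FourCycle.exists_rootSet_psi_real
  obtain ⟨v, hv, hpos, huniq⟩ := FourCycle.exists_pos_solution
  have hest (x : FourCycle.Cell) :
      FourCycle.estCount (FourCycle.table fun n ↦ v n / 13) x =
        13 * FourCycle.table (fun n ↦ v n / 13) x := by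
    rw [FourCycle.estCount, FourCycle.sum_counts]
    norm_num
  have hcell (n : Fin 12) :
      FourCycle.estCount (FourCycle.table fun n ↦ v n / 13) (FourCycle.cell n) = v n := by
    rw [hest, FourCycle.table_cell]
    ring
  have hl : FourCycle.estCount (FourCycle.table fun n ↦ v n / 13) (1, 0, 1, 1) = v 11 := hcell 11
  refine ⟨FourCycle.isGroebnerBasis_lexBasis FourCycle.comap_inclL_mleIdeal,
    FourCycle.setOf_inclL_mem_lexBasis, FourCycle.comap_inclL_mleIdeal, FourCycle.irreducible_psi,
    FourCycle.nonempty_gal_psi_mulEquiv, hncard, fun z ↦ FourCycle.not_mem_solvableByRad,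
    FourCycle.table fun n ↦ v n / 13, FourCycle.isMLE_iff hv hpos, FourCycle.table_one_one _,
    fun w ↦ ?_, ?_, ?_, ?_⟩
  · rw [FourCycle.forall_aeval_mleIdeal_eq_zero_iff]
    simp only [hcell]
    exact ⟨fun h ↦ huniq w h.2 h.1, fun h ↦ h ▸ ⟨fun n ↦ (hpos n).le, hv⟩⟩
  · rw [hl]
    exact hv.aeval_psi
  · rw [hl]
    rintro ⟨r, hr⟩
    -- A rational number is trivially expressible by radicals.
    refine FourCycle.not_mem_solvableByRad hv.aeval_psi ?_
    rw [← hr]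
    exact (solvableByRad ℚ ℝ).algebraMap_mem r
  · rw [hl]
    refine FourCycle.not_mem_solvableByRad ?_
    have := Polynomial.aeval_algebraMap_apply ℂ (v 11) FourCycle.psi
    rw [hv.aeval_psi, map_zero] at this
    exact this
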